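/- Let $G$ be a group (in particular, any finite group). Write $\mathbb{Z}[G]\text{-Chain}$ for the category of unbounded ($\mathbb{Z}$-graded) chain complexes of $\mathbb{Z}[G]$-modules and chain maps, and $h\mathbb{Z}[G]\text{-Chain}$ for its homotopy category (same objects, chain maps modulo chain homotopy), with quotient functor $Q:\mathbb{Z}[G]\text{-Chain}\to h\mathbb{Z}[G]\text{-Chain}$. A chain map $f:C\to D$ is called an *fp-equivalence* if for every subgroup $H\subseteq G$ the induced map on fixed points $f^H:C^H\to D^H$ is a quasi-isomorphism; a morphism of $h\mathbb{Z}[G]\text{-Chain}$ is called an fp-equivalence if for every $H\subseteq G$ it induces isomorphisms on all homology groups of the $H$-fixed points. For $H\subseteq G$ and $n\in\mathbb{Z}$ let $\mathbb{Z}[G/H][n]$ be the permutation module $\mathbb{Z}[G/H]$ regarded as a complex concentrated in degree $n$. A *cell chain complex* is a chain complex isomorphic to the colimit of a sequence of chain maps $$0=C_{(-1)}\to C_{(0)}\to C_{(1)}\to\cdots$$ in which, for each $n\ge -1$, $C_{(n)}\to C_{(n+1)}$ is (up to isomorphism under $C_{(n)}$) the canonical inclusion of $C_{(n)}$ into the mapping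 cone of a chain map $P_{(n)}\to C_{(n)}$, where $P_{(n)}$ is a (possibly empty or infinite) direct sum of complexes of the form $\mathbb{Z}[G/H_i][n_i]$. Let $h\mathrm{Cell}\subseteq h\mathbb{Z}[G]\text{-Chain}$ be the full subcategory on the cell chain complexes. **Proposition.** The localization (derived category) of $\mathbb{Z}[G]\text{-Chain}$ with respect to fp-equivalences exists, as a category with small Hom-sets, and is obtained by colocalization with respect to cell chain complexes. Precisely: 1. There are a category $D$ with small Hom-sets and a functor $\mathbb{Z}[G]\text{-Chain}\to D$ which is a localization at the class of fp-equivalences. 2. Cell chain complexes are colocal: if $C$ is a cell chain complex and $f:X\to Y$ is an fp-equivalence in $h\mathbb{Z}[G]\text{-Chain}$, then composition with $f$ is a bijection $h\mathbb{Z}[G]\text{-Chain}(C,X)\to h\mathbb{Z}[G]\text{-Chain}(C,Y)$. 3. For every chain complex $X$ of $\mathbb{Z}[G]$-modules there are a cell chain complex $C$ and a chain map $\gamma:C\to X$ which is an fp-equivalence. 4. The inclusion $h\mathrm{Cell}\to h\mathbb{Z}[G]\text{-Chain}$ has a right adjoint $\Gamma$ whose counit is an fp-equivalence at every object; $\Gamma$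 is a localization of $h\mathbb{Z}[G]\text{-Chain}$ at the fp-equivalences, and $\Gamma\circ Q:\mathbb{Z}[G]\text{-Chain}\to h\mathrm{Cell}$ is a localization of $\mathbb{Z}[G]\text{-Chain}$ at the fp-equivalences. -/

import Mathlib

universe u

open CategoryTheory CategoryTheory.Limits

noncomputable section

namespace FPDerived

variable (G : Type u) [Group G]

/-- The category of `ℤ[G]`-modules. -/
abbrev ZGMod : Type (u + 1) := ModuleCat.{u} (MonoidAlgebra ℤ G)

/-- The category of unbounded chain complexes `⋯ ⟶ C_n ⟶ C_{n-1} ⟶ ⋯`, `n ∈ ℤ`, of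
`ℤ[G]`-modules. -/
abbrev ZGChain : Type (u + 1) := ChainComplex (ZGMod G) ℤ

/-- The homotopy category of chain complexes of `ℤ[G]`-modules: same objects, with chain maps
up to chain homotopy. -/
abbrev ZGHo : Type (u + 1) := HomotopyCategory (ZGMod G) (ComplexShape.down ℤ)

/-- The quotient functor from chain complexes to the homotopy category. -/
abbrev toHo : ZGChain G ⥤ ZGHo G := HomotopyCategory.quotient (ZGMod G) (ComplexShape.down ℤ)

variable {G}

/-- The fixed points `M^H` of a `ℤ[G]`-module `M` under a subgroup `H`. -/
def fixedSubmodule (H : Subgroup G) (M : Type u) [AddCommGroup M]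
    [Module (MonoidAlgebra ℤ G) M] : Submodule ℤ M where
  carrier := {m | ∀ h ∈ H, MonoidAlgebra.of ℤ G h • m = m}
  zero_mem' := fun _ _ => smul_zero _
  add_mem' := fun {a b} ha hb h hh => by rw [smul_add, ha h hh, hb h hh]
  smul_mem' := fun n m hm h hh => by rw [smul_comm, hm h hh]

/-- The map `M^H ⟶ N^H` induced by a `ℤ[G]`-linear map. -/
def fixedMap (H : Subgroup G) {M N : Type u} [AddCommGroup M] [AddCommGroup N]
    [Module (MonoidAlgebra ℤ G) M] [Module (MonoidAlgebra ℤ G) N]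
    (f : M →ₗ[MonoidAlgebra ℤ G] N) : fixedSubmodule H M →ₗ[ℤ] fixedSubmodule H N :=
  f.toAddMonoidHom.toIntLinearMap.restrict (fun m hm h hh => by
    change MonoidAlgebra.of ℤ G h • f m = f m
    rw [← map_smul, hm h hh])

/-- The functor `M ↦ M^H` from `ℤ[G]`-modules to abelian groups. -/
def fixedPoints (H : Subgroup G) : ZGMod G ⥤ ModuleCat.{u} ℤ where
  obj M := ModuleCat.of ℤ (fixedSubmodule H M)
  map f := ModuleCat.ofHom (fixedMap H f.hom)
  map_id _ := rfl
  map_comp _ _ := rfl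

instance (H : Subgroup G) : (fixedPoints H).Additive where
  map_add := rfl

variable (G)

/-- A chain map `f` is an fp-equivalence if `f^H : C^H ⟶ D^H` is a quasi-isomorphism for every
subgroup `H` of `G`. -/
def fpEquivalences : MorphismProperty (ZGChain G) := fun _ _ f =>
  ∀ H : Subgroup G,
    QuasiIso (((fixedPoints H).mapHomologicalComplex (ComplexShape.down ℤ)).map f)

/-- The fp-equivalences in the homotopy category: the homotopy classes which induce isomorphisms
on the homology of `H`-fixed points in every degree, for every subgroup `H` of `G`. -/
def fpEquivalencesHo : MorphismProperty (ZGHo G) := fun _ _ f =>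
  ∀ (H : Subgroup G) (n : ℤ),
    IsIso ((HomotopyCategory.homologyFunctor (ModuleCat.{u} ℤ) (ComplexShape.down ℤ) n).map
      (((fixedPoints H).mapHomotopyCategory (ComplexShape.down ℤ)).map f))

variable {G}

/-- The permutation module `ℤ[G/H]`. -/
def permModule (H : Subgroup G) : ZGMod G :=
  ModuleCat.of (MonoidAlgebra ℤ G) (Representation.ofMulAction ℤ G (G ⧸ H)).asModule

/-- The chain complex `ℤ[G/H][n]`: the module `ℤ[G/H]` concentrated in degree `n`. -/
def permComplex (H : Subgroup G) (n : ℤ) : ZGChain G :=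
  (HomologicalComplex.single (ZGMod G) (ComplexShape.down ℤ) n).obj (permModule H)

/-- `P` is a direct sum of chain complexes of the form `ℤ[G/H_i][n_i]` (in particular its
differential is zero). -/
def IsPermSum (P : ZGChain G) : Prop :=
  ∃ (I : Type u) (H : I → Subgroup G) (n : I → ℤ),
    Nonempty (P ≅ ∐ fun i => permComplex (H i) (n i))

/-- The map `i : A ⟶ B` is, up to isomorphism under `A`, the inclusion of `A` in the mapping cone
of a chain map `P ⟶ A`, where `P` is a direct sum of complexes `ℤ[G/H_i][n_i]`. -/
def IsCellAttachment {A B : ZGChain G} (i : A ⟶ B) : Prop :=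
  ∃ (P : ZGChain G) (φ : P ⟶ A) (e : B ≅ HomologicalComplex.homotopyCofiber φ),
    IsPermSum P ∧ i ≫ e.hom = HomologicalComplex.homotopyCofiber.inr φ

/-- A cell chain complex: a colimit of a sequence `F 0 ⟶ F 1 ⟶ ⋯` which starts with `F 0 = 0`
and in which each `F (k + 1)` is the mapping cone of a map from a direct sum of complexes
`ℤ[G/H_i][n_i]` to `F k`. (Here `F k` is the stage usually numbered `k - 1`.) -/
def IsCellComplex (C : ZGChain G) : Prop :=
  ∃ (F : ℕ ⥤ ZGChain G) (c : Cocone F),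
    IsZero (F.obj 0) ∧
    (∀ k : ℕ, IsCellAttachment (F.map (homOfLE (Nat.le_succ k)))) ∧
    Nonempty (IsColimit c) ∧ Nonempty (c.pt ≅ C)

variable (G)

/-- The objects of the homotopy category that are cell chain complexes. -/
def cellObjects : ObjectProperty (ZGHo G) := fun X =>
  ∃ C : ZGChain G, IsCellComplex C ∧ X = (toHo G).obj C

/-- The full subcategory of the homotopy category on the cell chain complexes. -/
abbrev CellHo : Type (u + 1) := (cellObjects G).FullSubcategory

end FPDerived

end

/-! Maps `ℤ[G/H] ⟶ M` are the `H`-fixed elements of `M`, so permutation modules are projective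
relative to the maps that are surjective on all fixed points. Hence cell complexes lift along every
`p` satisfying `FPLift`, the analogue of a trivial fibration (`IsCellComplex.exists_lift`).

Colocality follows by replacing an fp-equivalence `f : X ⟶ Y` with the projection to `Y` of the
homotopy pullback of `f` and `𝟙 Y`, which satisfies `FPLift` (`fpLift_snd`): every map from a cell
complex to `Y` lifts to `X` up to homotopy. Uniqueness up to homotopy is the same statement for the
homotopy diagonal of `f`, again an fp-equivalence (`fpEquivalences_hoDiagonal`).

Approximations come from a small object argument of length `ω` (`fpLift_cellApproxMap`). Colocality
and approximations together make the cell complexes a coreflective subcategory of the homotopy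
category, and the coreflection `Γ` inverts exactly the fp-equivalences. Its Hom-sets are Hom-sets of
the homotopy category, hence small. -/

noncomputable section

namespace FPDerived

/-! ### Homology of complexes of modules in terms of elements. -/

section HomologyOfModules

variable {R : Type*} [Ring R] {ι : Type*} {c : ComplexShape ι}

lemma exists_iCycles_eq (K : HomologicalComplex (ModuleCat.{u} R) c) (i : ι) (x : K.X i)
    (hx : ∀ k, K.d i k x = 0) : ∃ z : K.cycles i, K.iCycles i z = x := by
  refine ⟨(K.sc i).moduleCatCyclesIso.inv ⟨x, hx _⟩, ?_⟩
  exact congr($((K.sc i).moduleCatCyclesIso_inv_iCycles) ⟨x, hx _⟩)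

lemma d_iCycles_apply (K : HomologicalComplex (ModuleCat.{u} R) c) (i k : ι) (z : K.cycles i) :
    K.d i k (K.iCycles i z) = 0 := by
  rw [← ConcreteCategory.comp_apply, K.iCycles_d]
  rfl

lemma iCycles_injective (K : HomologicalComplex (ModuleCat.{u} R) c) (i : ι) :
    Function.Injective (K.iCycles i) :=
  (ModuleCat.mono_iff_injective _).1 inferInstance

lemma homologyπ_surjective (K : HomologicalComplex (ModuleCat.{u} R) c) (i : ι) :
    Function.Surjective (K.homologyπ i) :=
  (ModuleCat.epi_iff_surjective _).1 inferInstance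

lemma homologyπ_apply_eq_zero_iff (K : HomologicalComplex (ModuleCat.{u} R) c) {i j : ι}
    (hij : c.Rel i j) (z : K.cycles j) :
    K.homologyπ j z = 0 ↔ ∃ w : K.X i, K.d i j w = K.iCycles j z := by
  have hex : (ShortComplex.mk (K.toCycles i j) (K.homologyπ j) (by simp)).Exact :=
    ShortComplex.exact_of_g_is_cokernel _ (K.homologyIsCokernel i j (c.prev_eq' hij))
  rw [ShortComplex.moduleCat_exact_iff] at hex
  constructor
  · intro h
    obtain ⟨w, hw⟩ := hex z h
    refine ⟨w, ?_⟩
    rw [← hw, ← K.toCycles_i i j]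
    rfl
  · rintro ⟨w, hw⟩
    have hz : K.toCycles i j w = z := by
      apply iCycles_injective
      rw [← hw, ← ConcreteCategory.comp_apply, K.toCycles_i]
    rw [← hz, ← ConcreteCategory.comp_apply, K.toCycles_comp_homologyπ]
    rfl

variable {K L : HomologicalComplex (ModuleCat.{u} R) c}

lemma iCycles_cyclesMap_apply (f : K ⟶ L) (j : ι) (z : K.cycles j) :
    L.iCycles j (HomologicalComplex.cyclesMap f j z) = f.f j (K.iCycles j z) := by
  rw [← ConcreteCategory.comp_apply, HomologicalComplex.cyclesMap_i]
  rfl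

lemma homologyMap_homologyπ_apply (f : K ⟶ L) (j : ι) (z : K.cycles j) :
    HomologicalComplex.homologyMap f j (K.homologyπ j z) =
      L.homologyπ j (HomologicalComplex.cyclesMap f j z) := by
  rw [← ConcreteCategory.comp_apply, HomologicalComplex.homologyπ_naturality]
  rfl

lemma homologyMap_injective_iff (f : K ⟶ L) {i j : ι} (hij : c.Rel i j) :
    Function.Injective (HomologicalComplex.homologyMap f j) ↔
      ∀ (x : K.X j) (y : L.X i), (∀ k, K.d j k x = 0) → L.d i j y = f.f j x →
        ∃ z : K.X i, K.d i j z = x := by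
  constructor
  · intro h x y hx hy
    obtain ⟨z, rfl⟩ := exists_iCycles_eq K j x hx
    rw [← homologyπ_apply_eq_zero_iff K hij]
    apply h
    rw [map_zero, homologyMap_homologyπ_apply, homologyπ_apply_eq_zero_iff L hij]
    exact ⟨y, by rw [hy, iCycles_cyclesMap_apply]⟩
  · intro h
    refine (injective_iff_map_eq_zero (HomologicalComplex.homologyMap f j).hom).2 fun a ha => ?_
    obtain ⟨z, rfl⟩ := homologyπ_surjective K j a
    replace ha : HomologicalComplex.homologyMap f j (K.homologyπ j z) = 0 := ha
    rw [homologyMap_homologyπ_apply, homologyπ_apply_eq_zero_iff L hij] at ha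
    obtain ⟨y, hy⟩ := ha
    rw [iCycles_cyclesMap_apply] at hy
    exact (homologyπ_apply_eq_zero_iff K hij z).2 (h _ y (fun k => d_iCycles_apply K j k z) hy)

lemma homologyMap_surjective_iff (f : K ⟶ L) {i j : ι} (hij : c.Rel i j) :
    Function.Surjective (HomologicalComplex.homologyMap f j) ↔
      ∀ y : L.X j, (∀ k, L.d j k y = 0) →
        ∃ (x : K.X j) (w : L.X i), (∀ k, K.d j k x = 0) ∧ L.d i j w = y - f.f j x := by
  constructor
  · intro h y hy
    obtain ⟨z, rfl⟩ := exists_iCycles_eq L j y hy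
    obtain ⟨a, ha⟩ := h (L.homologyπ j z)
    obtain ⟨x, rfl⟩ := homologyπ_surjective K j a
    -- The sign is flipped so that the boundary obtained is `y - f x` rather than `f x - y`.
    rw [homologyMap_homologyπ_apply, ← sub_eq_zero, ← map_sub, ← neg_eq_zero, ← map_neg, neg_sub,
      homologyπ_apply_eq_zero_iff L hij] at ha
    obtain ⟨w, hw⟩ := ha
    refine ⟨K.iCycles j x, w, fun k => d_iCycles_apply K j k x, ?_⟩
    rw [hw, map_sub, iCycles_cyclesMap_apply]
  · intro h a
    obtain ⟨z, rfl⟩ := homologyπ_surjective L j a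
    obtain ⟨x, w, hx, hw⟩ := h (L.iCycles j z) (fun k => d_iCycles_apply L j k z)
    obtain ⟨x, rfl⟩ := exists_iCycles_eq K j x hx
    refine ⟨K.homologyπ j x, ?_⟩
    rw [homologyMap_homologyπ_apply, ← sub_eq_zero, ← map_sub, ← neg_eq_zero, ← map_neg, neg_sub,
      homologyπ_apply_eq_zero_iff L hij]
    exact ⟨w, by rw [hw, map_sub, iCycles_cyclesMap_apply]⟩

lemma quasiIsoAt_iff_elements (f : K ⟶ L) {i j : ι} (hij : c.Rel i j) :
    QuasiIsoAt f j ↔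
      (∀ (x : K.X j) (y : L.X i), (∀ k, K.d j k x = 0) → L.d i j y = f.f j x →
        ∃ z : K.X i, K.d i j z = x) ∧
      (∀ y : L.X j, (∀ k, L.d j k y = 0) →
        ∃ (x : K.X j) (w : L.X i), (∀ k, K.d j k x = 0) ∧ L.d i j w = y - f.f j x) := by
  rw [quasiIsoAt_iff_isIso_homologyMap, ← homologyMap_injective_iff f hij,
    ← homologyMap_surjective_iff f hij, ConcreteCategory.isIso_iff_bijective]
  rfl

end HomologyOfModules

/-! ### Fp-equivalences in terms of fixed elements. -/

variable {G : Type u} [Group G]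

/-- An elementwise form of the injectivity and surjectivity on the homology of fixed points. -/
lemma fpEquivalences_iff {X Y : ZGChain G} (f : X ⟶ Y) :
    fpEquivalences G f ↔ ∀ (H : Subgroup G) (n : ℤ),
      (∀ x ∈ fixedSubmodule H (X.X n), ∀ y ∈ fixedSubmodule H (Y.X (n + 1)),
        (∀ k, X.d n k x = 0) → Y.d (n + 1) n y = f.f n x →
          ∃ z ∈ fixedSubmodule H (X.X (n + 1)), X.d (n + 1) n z = x) ∧
      (∀ y ∈ fixedSubmodule H (Y.X n), (∀ k, Y.d n k y = 0) →
        ∃ x ∈ fixedSubmodule H (X.X n), ∃ w ∈ fixedSubmodule H (Y.X (n + 1)),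
          (∀ k, X.d n k x = 0) ∧ Y.d (n + 1) n w = y - f.f n x) := by
  refine forall_congr' fun H => ?_
  rw [quasiIso_iff]
  refine forall_congr' fun n => ?_
  rw [quasiIsoAt_iff_elements _ (i := n + 1) (j := n) rfl]
  refine and_congr ⟨fun h x hx y hy hd hf => ?_, fun h x y hd hf => ?_⟩
    ⟨fun h y hy hd => ?_, fun h y hd => ?_⟩
  · obtain ⟨z, hz⟩ := h ⟨x, hx⟩ ⟨y, hy⟩ (fun k => Subtype.ext (hd k)) (Subtype.ext hf)
    exact ⟨z.1, z.2, congr_arg Subtype.val hz⟩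
  · obtain ⟨z, hz, hz'⟩ := h x.1 x.2 y.1 y.2 (fun k => congr_arg Subtype.val (hd k))
      (congr_arg Subtype.val hf)
    exact ⟨⟨z, hz⟩, Subtype.ext hz'⟩
  · obtain ⟨x, w, hx, hw⟩ := h ⟨y, hy⟩ (fun k => Subtype.ext (hd k))
    exact ⟨x.1, x.2, w.1, w.2, fun k => congr_arg Subtype.val (hx k), congr_arg Subtype.val hw⟩
  · obtain ⟨x, hx, w, hw, hd', hw'⟩ := h y.1 y.2 (fun k => congr_arg Subtype.val (hd k))
    exact ⟨⟨x, hx⟩, ⟨w, hw⟩, fun k => Subtype.ext (hd' k), Subtype.ext hw'⟩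

lemma fpEquivalencesHo_map_iff {X Y : ZGChain G} (f : X ⟶ Y) :
    fpEquivalencesHo G ((toHo G).map f) ↔ fpEquivalences G f := by
  refine forall_congr' fun H => ?_
  rw [quasiIso_iff]
  refine forall_congr' fun n => ?_
  rw [quasiIsoAt_iff_isIso_homologyMap, Functor.mapHomotopyCategory_map]
  exact NatIso.isIso_map_iff (HomotopyCategory.homologyFunctorFactors (ModuleCat.{u} ℤ)
    (ComplexShape.down ℤ) n) (((fixedPoints H).mapHomologicalComplex _).map f)

/-! ### Projectivity relative to fixed points; permutation modules. -/

section Modules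

/-- A map of `ℤ[G]`-modules which is surjective on the fixed points of every subgroup. -/
def FPSurjective {S T : ZGMod G} (p : S ⟶ T) : Prop :=
  ∀ (H : Subgroup G), ∀ t ∈ fixedSubmodule H T, ∃ s ∈ fixedSubmodule H S, p s = t

/-- A module which is projective relative to the maps that are surjective on fixed points. -/
def IsFPProjective (M : ZGMod G) : Prop :=
  ∀ ⦃S T : ZGMod G⦄ (p : S ⟶ T), FPSurjective p → ∀ g : M ⟶ T, ∃ h : M ⟶ S, h ≫ p = g

lemma map_mem_fixedSubmodule {M N : ZGMod G} (f : M ⟶ N) {H : Subgroup G} {m : M}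
    (hm : m ∈ fixedSubmodule H M) : f m ∈ fixedSubmodule H N :=
  (fixedMap H f.hom ⟨m, hm⟩).2

/-- The element `r • q` of `ℤ[G/H]`. -/
def permSingle {H : Subgroup G} (q : G ⧸ H) (r : ℤ) : permModule H :=
  (Representation.ofMulAction ℤ G (G ⧸ H)).asModuleEquiv.symm (MonoidAlgebra.single q r)

/-- The class of the trivial coset in `ℤ[G/H]`. -/
def permGen (H : Subgroup G) : permModule H := permSingle ((1 : G) : G ⧸ H) 1

lemma of_smul_permSingle {H : Subgroup G} (g : G) (q : G ⧸ H) (r : ℤ) :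
    MonoidAlgebra.of ℤ G g • permSingle q r = permSingle (g • q) r := by
  have h := Representation.asModuleEquiv_symm_map_rho (Representation.ofMulAction ℤ G (G ⧸ H)) g
    (MonoidAlgebra.single q r)
  rw [Representation.ofMulAction_single] at h
  exact h.symm

lemma permSingle_eq_smul {H : Subgroup G} (q : G ⧸ H) (r : ℤ) :
    permSingle q r = r • permSingle q 1 := by
  have h : MonoidAlgebra.single q r = r • MonoidAlgebra.single q (1 : ℤ) := by simp
  exact (congr_arg (Representation.ofMulAction ℤ G (G ⧸ H)).asModuleEquiv.symm h).trans
    (map_zsmul (Representation.ofMulAction ℤ G (G ⧸ H)).asModuleEquiv.symm r _)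

lemma permModule_induction {H : Subgroup G} {p : permModule H → Prop} (v : permModule H)
    (zero : p 0) (add : ∀ v w, p v → p w → p (v + w)) (single : ∀ q r, p (permSingle q r)) :
    p v := by
  suffices h : ∀ w : (G ⧸ H) →₀ ℤ, p ((Representation.ofMulAction ℤ G (G ⧸ H)).asModuleEquiv.symm
      (MonoidAlgebra.ofCoeff w)) from h (MonoidAlgebra.coeff _)
  intro w
  induction w using Finsupp.induction_linear with
  | zero => exact zero
  | add a b ha hb => exact add _ _ ha hb
  | single q r => exact single q r

lemma permGen_mem_fixedSubmodule (H : Subgroup G) :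
    permGen H ∈ fixedSubmodule H (permModule H) := by
  intro h hh
  refine (of_smul_permSingle h _ _).trans ?_
  have : h • ((1 : G) : G ⧸ H) = ((1 : G) : G ⧸ H) := by
    change ((h * 1 : G) : G ⧸ H) = _
    rw [QuotientGroup.eq]
    simpa using hh
  rw [this]
  rfl

/-- The orbit map `G/H → M` of an `H`-fixed element. -/
def orbitMap {H : Subgroup G} {M : Type u} [AddCommGroup M] [Module (MonoidAlgebra ℤ G) M]
    (m : M) (hm : m ∈ fixedSubmodule H M) (q : G ⧸ H) : M :=
  Quotient.liftOn' q (fun g => MonoidAlgebra.of ℤ G g • m) (fun a b hab => by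
    rw [QuotientGroup.leftRel_apply] at hab
    have := hm _ hab
    change MonoidAlgebra.of ℤ G a • m = MonoidAlgebra.of ℤ G b • m
    rw [← this, smul_smul, ← map_mul, mul_inv_cancel_left]
    rw [this])

lemma orbitMap_smul {H : Subgroup G} {M : Type u} [AddCommGroup M] [Module (MonoidAlgebra ℤ G) M]
    (m : M) (hm : m ∈ fixedSubmodule H M) (g : G) (q : G ⧸ H) :
    orbitMap m hm (g • q) = MonoidAlgebra.of ℤ G g • orbitMap m hm q := by
  induction q using QuotientGroup.induction_on with
  | H a =>
    change MonoidAlgebra.of ℤ G (g * a) • m = MonoidAlgebra.of ℤ G g • MonoidAlgebra.of ℤ G a • m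
    rw [map_mul, mul_smul]

/-- The additive map underlying `permDesc`. -/
def permDescAux {H : Subgroup G} {M : ZGMod G} (m : M) (hm : m ∈ fixedSubmodule H M) :
    permModule H →+ M :=
  (Finsupp.linearCombination ℤ (orbitMap m hm)).toAddMonoidHom.comp
    (MonoidAlgebra.coeffAddEquiv.toAddMonoidHom.comp
      (Representation.ofMulAction ℤ G (G ⧸ H)).asModuleEquiv.toLinearMap.toAddMonoidHom)

lemma permDescAux_permSingle {H : Subgroup G} {M : ZGMod G} (m : M) (hm : m ∈ fixedSubmodule H M)
    (q : G ⧸ H) (r : ℤ) : permDescAux m hm (permSingle q r) = r • orbitMap m hm q :=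
  Finsupp.linearCombination_single ℤ r q

lemma permDescAux_smul {H : Subgroup G} {M : ZGMod G} (m : M) (hm : m ∈ fixedSubmodule H M)
    (a : MonoidAlgebra ℤ G) (v : permModule H) :
    permDescAux m hm (a • v) = a • permDescAux m hm v := by
  induction a using MonoidAlgebra.induction_on with
  | of g =>
    induction v using permModule_induction with
    | zero => simp
    | add v w hv hw => rw [smul_add, map_add, hv, hw, map_add, smul_add]
    | single q r =>
      rw [of_smul_permSingle, permDescAux_permSingle, permDescAux_permSingle, orbitMap_smul,
        smul_comm]
  | add a b ha hb => rw [add_smul, map_add, ha, hb, add_smul]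
  | smul r a ha => rw [smul_assoc, map_zsmul, ha, smul_assoc]

/-- The map `ℤ[G/H] ⟶ M` determined by an `H`-fixed element of `M`. -/
def permDesc {H : Subgroup G} {M : ZGMod G} (m : M) (hm : m ∈ fixedSubmodule H M) :
    permModule H ⟶ M :=
  ModuleCat.ofHom
    { toFun := permDescAux m hm
      map_add' := map_add _
      map_smul' := permDescAux_smul m hm }

lemma permDesc_permGen {H : Subgroup G} {M : ZGMod G} (m : M) (hm : m ∈ fixedSubmodule H M) :
    permDesc m hm (permGen H) = m := by
  refine (permDescAux_permSingle m hm _ _).trans ?_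
  rw [one_smul]
  change MonoidAlgebra.of ℤ G 1 • m = m
  rw [map_one, one_smul]

/-- The trivial coset generates `ℤ[G/H]` over `ℤ[G]`. With `permDesc_permGen` this gives
`Hom(ℤ[G/H], M) = M^H`. -/
lemma permModule_hom_ext {H : Subgroup G} {M : ZGMod G} {f g : permModule H ⟶ M}
    (h : f (permGen H) = g (permGen H)) : f = g := by
  ext v
  induction v using permModule_induction with
  | zero => rw [map_zero, map_zero]
  | add a b ha hb => rw [map_add, map_add, ha, hb]
  | single q r =>
    obtain ⟨a, rfl⟩ := QuotientGroup.mk_surjective q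
    have h1 : (permSingle (a : G ⧸ H) r : permModule H) =
        r • MonoidAlgebra.of ℤ G a • permGen H := by
      rw [permGen, of_smul_permSingle]
      change permSingle (a : G ⧸ H) r = r • permSingle (((a * 1 : G)) : G ⧸ H) 1
      rw [mul_one]
      exact permSingle_eq_smul _ _
    rw [h1, map_zsmul, map_zsmul, map_smul, map_smul]
    exact congr_arg (fun x => r • MonoidAlgebra.of ℤ G a • x) h

/-- Lifting a map out of `ℤ[G/H]` amounts to lifting one `H`-fixed element to an `H`-fixed element.
-/
lemma isFPProjective_permModule (H : Subgroup G) : IsFPProjective (permModule H) := by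
  intro S T p hp g
  obtain ⟨s, hs, hs'⟩ := hp H _ (map_mem_fixedSubmodule g (permGen_mem_fixedSubmodule H))
  refine ⟨permDesc s hs, permModule_hom_ext ?_⟩
  rw [ConcreteCategory.comp_apply, permDesc_permGen, hs']

lemma IsFPProjective.of_iso {M N : ZGMod G} (hM : IsFPProjective M) (e : M ≅ N) :
    IsFPProjective N := by
  intro S T p hp g
  obtain ⟨h, hh⟩ := hM p hp (e.hom ≫ g)
  exact ⟨e.inv ≫ h, by simp [hh]⟩

lemma isFPProjective_of_isZero {M : ZGMod G} (hM : IsZero M) : IsFPProjective M :=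
  fun _ _ _ _ _ => ⟨0, hM.eq_of_src _ _⟩

lemma isFPProjective_of_isColimit {J : Type*} {F : Discrete J ⥤ ZGMod G} {c : Cocone F}
    (hc : IsColimit c) (hF : ∀ j, IsFPProjective (F.obj j)) : IsFPProjective c.pt := by
  intro S T p hp g
  choose h hh using fun j => hF j p hp (c.ι.app j ≫ g)
  exact ⟨hc.desc ⟨S, Discrete.natTrans h⟩, hc.hom_ext fun j => by
    rw [hc.fac_assoc]; exact hh j⟩

end Modules

lemma isFPProjective_permComplex_X (H : Subgroup G) (n i : ℤ) :
    IsFPProjective ((permComplex H n).X i) := by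
  by_cases h : i = n
  · subst h
    exact (isFPProjective_permModule H).of_iso
      (HomologicalComplex.singleObjXSelf (ComplexShape.down ℤ) i (permModule H)).symm
  · exact isFPProjective_of_isZero (HomologicalComplex.isZero_single_obj_X _ _ _ _ h)

lemma IsPermSum.isFPProjective_X {P : ZGChain G} (hP : IsPermSum P) (i : ℤ) :
    IsFPProjective (P.X i) := by
  obtain ⟨I, H, n, ⟨e⟩⟩ := hP
  refine IsFPProjective.of_iso ?_ ((HomologicalComplex.eval _ _ i).mapIso e.symm)
  exact isFPProjective_of_isColimit
    (isColimitOfPreserves (HomologicalComplex.eval _ _ i)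
      (colimit.isColimit (Discrete.functor fun i => permComplex (H i) (n i))))
    (fun j => isFPProjective_permComplex_X _ _ _)

lemma IsPermSum.d_eq_zero {P : ZGChain G} (hP : IsPermSum P) (i j : ℤ) : P.d i j = 0 := by
  obtain ⟨I, H, n, ⟨e⟩⟩ := hP
  have h : (∐ fun i => permComplex (H i) (n i)).d i j = 0 := by
    refine (isColimitOfPreserves (HomologicalComplex.eval _ _ i)
      (colimit.isColimit (Discrete.functor fun i => permComplex (H i) (n i)))).hom_ext fun k => ?_
    refine (HomologicalComplex.Hom.comm
      (colimit.ι (Discrete.functor fun i => permComplex (H i) (n i)) k) i j).trans ?_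
    have : ((Discrete.functor fun i => permComplex (H i) (n i)).obj k).d i j = 0 :=
      HomologicalComplex.single_obj_d _ _ _ _ _
    rw [this, zero_comp]
    exact comp_zero.symm
  have h' := e.hom.comm i j
  rw [h, comp_zero] at h'
  rw [← cancel_mono (e.hom.f j), ← h', zero_comp]

/-! ### Lifting maps out of cell complexes. -/

section Lifting

/-- An elementwise lifting property of `p`: the right lifting property with respect to the
inclusions of `ℤ[G/H][n]` in its cone. -/
def FPLift {E B : ZGChain G} (p : E ⟶ B) : Prop :=
  ∀ (H : Subgroup G) (n : ℤ), ∀ e ∈ fixedSubmodule H (E.X n),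
    ∀ b ∈ fixedSubmodule H (B.X (n + 1)), (∀ k, E.d n k e = 0) → B.d (n + 1) n b = p.f n e →
      ∃ z ∈ fixedSubmodule H (E.X (n + 1)), E.d (n + 1) n z = e ∧ p.f (n + 1) z = b

lemma d_d_apply (E : ZGChain G) (i j k : ℤ) (x : E.X i) : E.d j k (E.d i j x) = 0 := by
  rw [← ConcreteCategory.comp_apply, E.d_comp_d]
  rfl

lemma f_d_apply {E B : ZGChain G} (p : E ⟶ B) (i j : ℤ) (x : E.X i) :
    p.f j (E.d i j x) = B.d i j (p.f i x) := by
  rw [← ConcreteCategory.comp_apply, ← ConcreteCategory.comp_apply, p.comm]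

/-- The pairs of a cycle `e` of `E` and of an element of `B` with boundary `p e`. -/
def boundaryPairs {E B : ZGChain G} (p : E ⟶ B) (n : ℤ) :
    Submodule (MonoidAlgebra ℤ G) (E.X n × B.X (n + 1)) where
  carrier := {t | (∀ k, E.d n k t.1 = 0) ∧ B.d (n + 1) n t.2 = p.f n t.1}
  zero_mem' := by simp
  add_mem' := by
    rintro a b ⟨ha, ha'⟩ ⟨hb, hb'⟩
    exact ⟨fun _ => by simp [ha, hb], by simp [ha', hb']⟩
  smul_mem' := by
    rintro r a ⟨ha, ha'⟩
    exact ⟨fun k => by simp [ha], by simp [ha']⟩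

/-- The map `z ↦ (d z, p z)`. -/
def toBoundaryPairs {E B : ZGChain G} (p : E ⟶ B) (n : ℤ) :
    E.X (n + 1) ⟶ ModuleCat.of (MonoidAlgebra ℤ G) (boundaryPairs p n) :=
  ModuleCat.ofHom (LinearMap.codRestrict _ ((E.d (n + 1) n).hom.prod (p.f (n + 1)).hom)
    (fun z => ⟨fun _ => d_d_apply E _ _ _ z, (f_d_apply p _ _ z).symm⟩))

/-- Recasts `FPLift` as surjectivity on fixed points of a single module map, the form to which
relative projectivity applies. -/
lemma FPLift.fpSurjective_toBoundaryPairs {E B : ZGChain G} {p : E ⟶ B} (hp : FPLift p) (n : ℤ) :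
    FPSurjective (toBoundaryPairs p n) := by
  intro H t ht
  obtain ⟨z, hz, h₁, h₂⟩ := hp H n t.1.1 (fun h hh => congr_arg (fun t => t.1.1) (ht h hh))
    t.1.2 (fun h hh => congr_arg (fun t => t.1.2) (ht h hh)) t.2.1 t.2.2
  exact ⟨z, hz, Subtype.ext (Prod.ext h₁ h₂)⟩

lemma FPLift.exists_lift {E B : ZGChain G} {p : E ⟶ B} (hp : FPLift p) {M : ZGMod G}
    (hM : IsFPProjective M) {i j : ℤ} (hij : i + 1 = j) (a : M ⟶ E.X i) (b : M ⟶ B.X j)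
    (ha : ∀ k, a ≫ E.d i k = 0) (hab : b ≫ B.d j i = a ≫ p.f i) :
    ∃ h : M ⟶ E.X j, h ≫ E.d j i = a ∧ h ≫ p.f j = b := by
  subst hij
  let t : M ⟶ ModuleCat.of (MonoidAlgebra ℤ G) (boundaryPairs p i) :=
    ModuleCat.ofHom (LinearMap.codRestrict _ (a.hom.prod b.hom) (fun m =>
      ⟨fun k => ConcreteCategory.congr_hom (ha k) m, ConcreteCategory.congr_hom hab m⟩))
  obtain ⟨h, hh⟩ := hM _ (hp.fpSurjective_toBoundaryPairs i) t
  refine ⟨h, ?_, ?_⟩ <;> ext m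
  · exact congr_arg (fun t => t.1.1) (ConcreteCategory.congr_hom hh m)
  · exact congr_arg (fun t => t.1.2) (ConcreteCategory.congr_hom hh m)

/-- A null-homotopy of a map from a complex with zero differential. -/
def homotopyZeroOfDEqZero {P E : ZGChain G} (hP : ∀ i j, P.d i j = 0) (a : P ⟶ E)
    (h : ∀ i j : ℤ, i + 1 = j → (P.X i ⟶ E.X j))
    (hh : ∀ i j hij, h i j hij ≫ E.d j i = a.f i) : Homotopy a 0 where
  hom i j := if hij : i + 1 = j then h i j hij else 0
  zero i j hij := dif_neg hij
  comm i := by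
    rw [prevD_eq _ (show (ComplexShape.down ℤ).Rel (i + 1) i from rfl), dif_pos rfl, hh]
    simp [dNext, hP]

/-- As `P` has zero differential, a null-homotopy of `a` is a family of maps `h` with `h ≫ d = a`,
with no condition linking different degrees. Each can therefore be chosen separately by
`FPLift.exists_lift`. -/
lemma FPLift.exists_homotopy {E B : ZGChain G} {p : E ⟶ B} (hp : FPLift p) {P : ZGChain G}
    (hP : IsPermSum P) (a : P ⟶ E) (hb : Homotopy (a ≫ p) 0) :
    ∃ h : Homotopy a 0, ∀ i j, (ComplexShape.down ℤ).Rel j i → h.hom i j ≫ p.f j = hb.hom i j := by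
  have key : ∀ (i j : ℤ) (hij : i + 1 = j),
      ∃ h : P.X i ⟶ E.X j, h ≫ E.d j i = a.f i ∧ h ≫ p.f j = hb.hom i j := by
    intro i j hij
    refine hp.exists_lift (hP.isFPProjective_X i) hij _ _ (fun k => ?_) ?_
    · rw [a.comm, hP.d_eq_zero, zero_comp]
    · have := hb.comm i
      rw [prevD_eq _ (show (ComplexShape.down ℤ).Rel j i from hij)] at this
      simpa [dNext, hP.d_eq_zero] using this.symm
  choose h h₁ h₂ using key
  refine ⟨homotopyZeroOfDEqZero hP.d_eq_zero a h h₁, fun i j hij => ?_⟩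
  change (if hij : i + 1 = j then h i j hij else 0) ≫ _ = _
  rw [dif_pos (show i + 1 = j from hij), h₂]

lemma down_exists_rel (j : ℤ) : ∃ i, (ComplexShape.down ℤ).Rel i j := ⟨j + 1, rfl⟩

/-- A map out of the cone of `φ` is a map `a` on `A` together with a null-homotopy of `φ ≫ a`. A
lift in the square is thus a lift of the null-homotopy given by `b`. -/
lemma FPLift.hasLiftingProperty_inr {E B : ZGChain G} {p : E ⟶ B} (hp : FPLift p)
    {P A : ZGChain G} (hP : IsPermSum P) (φ : P ⟶ A) :
    HasLiftingProperty (HomologicalComplex.homotopyCofiber.inr φ) p where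
  sq_hasLift {a b} sq := by
    let hb₀ := (HomologicalComplex.homotopyCofiber.inrCompHomotopy φ down_exists_rel).compRight b
    let hb : Homotopy ((φ ≫ a) ≫ p) 0 :=
      (Homotopy.ofEq (by rw [Category.assoc, Category.assoc, sq.w])).trans
        (hb₀.trans (Homotopy.ofEq zero_comp))
    obtain ⟨h, hh⟩ := hp.exists_homotopy hP (φ ≫ a) hb
    refine ⟨⟨⟨HomologicalComplex.homotopyCofiber.desc φ a h, by simp, ?_⟩⟩⟩
    ext1 j
    refine HomologicalComplex.homotopyCofiber.ext_from_X φ (j - 1) j (by simp) ?_ ?_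
    · rw [HomologicalComplex.comp_f,
        HomologicalComplex.homotopyCofiber.inlX_desc_f_assoc, hh _ _ (by simp)]
      simp [hb, hb₀, HomologicalComplex.homotopyCofiber.inrCompHomotopy_hom _ _ (j - 1) j]
    · rw [HomologicalComplex.comp_f,
        HomologicalComplex.homotopyCofiber.inrX_desc_f_assoc]
      exact congr_arg (fun f => HomologicalComplex.Hom.f f j) sq.w

lemma FPLift.hasLiftingProperty_cellAttachment {E B : ZGChain G} {p : E ⟶ B} (hp : FPLift p)
    {A A' : ZGChain G} {i : A ⟶ A'} (hi : IsCellAttachment i) : HasLiftingProperty i p := by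
  obtain ⟨P, φ, e, hP, hie⟩ := hi
  have := hp.hasLiftingProperty_inr hP φ
  rw [(Iso.eq_comp_inv e).2 hie]
  infer_instance

/-- A map out of a cell complex lifts along a map with the lifting property `FPLift`. -/
lemma IsCellComplex.exists_lift {C : ZGChain G} (hC : IsCellComplex C) {E B : ZGChain G}
    {p : E ⟶ B} (hp : FPLift p) (g : C ⟶ B) : ∃ h : C ⟶ E, h ≫ p = g := by
  obtain ⟨F, c, h0, hF, ⟨hc⟩, ⟨e⟩⟩ := hC
  have : HasLiftingProperty (c.ι.app ⊥) p :=
    HasLiftingProperty.transfiniteComposition.hasLiftingProperty_ι_app_bot hc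
      (fun j _ => hp.hasLiftingProperty_cellAttachment (hF j))
  -- The stage `F.obj ⊥` is zero, so the square commutes automatically and its diagonal is the
  -- desired lift.
  have sq : CommSq (0 : F.obj ⊥ ⟶ E) (c.ι.app ⊥) p (e.hom ≫ g) :=
    ⟨IsZero.eq_of_src h0 _ _⟩
  exact ⟨e.inv ≫ sq.lift, by simp⟩

end Lifting

/-! ### Homotopy pullbacks of chain maps. -/

section HomotopyPullback

variable {X Y Z : ZGChain G} (f : X ⟶ Z) (g : Y ⟶ Z)

/-- The differential `(x, y, z) ↦ (d x, d y, f x - g y - d z)` of the homotopy pullback. -/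
def hoPullbackD (n : ℤ) :
    ModuleCat.of (MonoidAlgebra ℤ G) (X.X (n + 1) × Y.X (n + 1) × Z.X (n + 1 + 1)) ⟶
      ModuleCat.of (MonoidAlgebra ℤ G) (X.X n × Y.X n × Z.X (n + 1)) :=
  ModuleCat.ofHom
    { toFun := fun t => (X.d (n + 1) n t.1, Y.d (n + 1) n t.2.1,
        f.f (n + 1) t.1 - g.f (n + 1) t.2.1 - Z.d (n + 1 + 1) (n + 1) t.2.2)
      map_add' := fun s t => by
        refine Prod.ext (by simp) (Prod.ext (by simp) ?_)
        simp only [Prod.fst_add, Prod.snd_add, map_add]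
        abel
      map_smul' := fun r t => by
        refine Prod.ext (by simp) (Prod.ext (by simp) ?_)
        simp [smul_sub] }

/-- The homotopy pullback of two chain maps. -/
def hoPullback : ZGChain G :=
  ChainComplex.of (fun n => ModuleCat.of (MonoidAlgebra ℤ G) (X.X n × Y.X n × Z.X (n + 1)))
    (hoPullbackD f g) (fun n => by
      refine ModuleCat.hom_ext (LinearMap.ext fun t => ?_)
      refine Prod.ext (d_d_apply X _ _ _ t.1) (Prod.ext (d_d_apply Y _ _ _ t.2.1) ?_)
      change f.f (n + 1) (X.d _ _ t.1) - g.f (n + 1) (Y.d _ _ t.2.1) -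
        Z.d _ _ (f.f _ t.1 - g.f _ t.2.1 - Z.d _ _ t.2.2) = 0
      rw [f_d_apply, f_d_apply, map_sub, map_sub, d_d_apply]
      abel)

lemma hoPullback_d (n : ℤ) (t : X.X (n + 1) × Y.X (n + 1) × Z.X (n + 1 + 1)) :
    (hoPullback f g).d (n + 1) n t = (X.d (n + 1) n t.1, Y.d (n + 1) n t.2.1,
        f.f (n + 1) t.1 - g.f (n + 1) t.2.1 - Z.d (n + 1 + 1) (n + 1) t.2.2) :=
  ConcreteCategory.congr_hom (show (hoPullback f g).d (n + 1) n = hoPullbackD f g n from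
    ChainComplex.of_d (fun n => ModuleCat.of (MonoidAlgebra ℤ G) (X.X n × Y.X n × Z.X (n + 1)))
      (hoPullbackD f g) n) t

namespace hoPullback

/-- A chain map determined by its components and its compatibility with `d (n + 1) n`. -/
@[simps]
def mkHom {C D : ZGChain G} (a : ∀ n, C.X n ⟶ D.X n)
    (h : ∀ n (x : C.X (n + 1)), D.d (n + 1) n (a (n + 1) x) = a n (C.d (n + 1) n x)) : C ⟶ D where
  f := a
  comm' i j hij := by
    obtain rfl : j + 1 = i := hij
    ext x
    exact h j x

/-- The first projection. -/
def fst : hoPullback f g ⟶ X :=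
  mkHom (fun _ => ModuleCat.ofHom (LinearMap.fst _ _ _)) (fun n t =>
    (congr_arg Prod.fst (hoPullback_d f g n t)).symm)

/-- The second projection. -/
def snd : hoPullback f g ⟶ Y :=
  mkHom (fun _ => ModuleCat.ofHom ((LinearMap.fst _ _ _).comp (LinearMap.snd _ _ _))) (fun n t =>
    (congr_arg (fun t => t.2.1) (hoPullback_d f g n t)).symm)

/-- The map to the homotopy pullback given by two maps and a homotopy. -/
def lift {C : ZGChain G} (a : C ⟶ X) (b : C ⟶ Y) (h : Homotopy (a ≫ f) (b ≫ g)) :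
    C ⟶ hoPullback f g :=
  mkHom (fun n => ModuleCat.ofHom ((a.f n).hom.prod ((b.f n).hom.prod (h.hom n (n + 1)).hom)))
    (fun n x => by
      refine (hoPullback_d f g n _).trans ?_
      refine Prod.ext (f_d_apply a _ _ x).symm (Prod.ext (f_d_apply b _ _ x).symm ?_)
      have := h.comm (n + 1)
      rw [prevD_eq _ (show (ComplexShape.down ℤ).Rel (n + 1 + 1) (n + 1) from rfl),
        dNext_eq _ (show (ComplexShape.down ℤ).Rel (n + 1) n from rfl)] at this
      have := ConcreteCategory.congr_hom this x
      change f.f _ (a.f _ x) = h.hom _ _ (C.d _ _ x) + Z.d _ _ (h.hom _ _ x) + g.f _ (b.f _ x)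
        at this
      change f.f _ (a.f _ x) - g.f _ (b.f _ x) - Z.d _ _ (h.hom _ _ x) = h.hom _ _ (C.d _ _ x)
      rw [this]
      abel)

lemma lift_fst {C : ZGChain G} (a : C ⟶ X) (b : C ⟶ Y) (h : Homotopy (a ≫ f) (b ≫ g)) :
    lift f g a b h ≫ fst f g = a := rfl

lemma lift_snd {C : ZGChain G} (a : C ⟶ X) (b : C ⟶ Y) (h : Homotopy (a ≫ f) (b ≫ g)) :
    lift f g a b h ≫ snd f g = b := rfl

/-- The third projection, which is not compatible with the differentials. -/
def thd (i j : ℤ) (hij : i + 1 = j) : (hoPullback f g).X i ⟶ Z.X j :=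
  ModuleCat.ofHom ((LinearMap.snd _ _ _).comp (LinearMap.snd (MonoidAlgebra ℤ G) (X.X i)
    (Y.X i × Z.X (i + 1)))) ≫ (Z.XIsoOfEq hij).hom

/-- The canonical homotopy which makes the square of the homotopy pullback commute. -/
def homotopy : Homotopy (fst f g ≫ f) (snd f g ≫ g) where
  hom i j := if hij : i + 1 = j then thd f g i j hij else 0
  zero i j hij := dif_neg hij
  comm i := by
    obtain ⟨i, rfl⟩ : ∃ k, k + 1 = i := ⟨i - 1, by simp⟩
    rw [prevD_eq _ (show (ComplexShape.down ℤ).Rel (i + 1 + 1) (i + 1) from rfl),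
        dNext_eq _ (show (ComplexShape.down ℤ).Rel (i + 1) i from rfl), dif_pos rfl, dif_pos rfl]
    ext t
    have : thd f g i (i + 1) rfl ((hoPullback f g).d (i + 1) i t) =
        f.f (i + 1) t.1 - g.f (i + 1) t.2.1 - Z.d (i + 1 + 1) (i + 1) t.2.2 :=
      congr_arg (fun t => t.2.2) (hoPullback_d f g i t)
    change f.f (i + 1) t.1 = thd f g i (i + 1) rfl ((hoPullback f g).d (i + 1) i t) +
      Z.d (i + 1 + 1) (i + 1) t.2.2 + g.f (i + 1) t.2.1
    rw [this]
    abel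

end hoPullback

end HomotopyPullback

lemma d_apply_eq_zero_of_succ {E : ZGChain G} {n : ℤ} {x : E.X (n + 1)}
    (hx : E.d (n + 1) n x = 0) (k : ℤ) : E.d (n + 1) k x = 0 := by
  by_cases h : k = n
  · subst h
    exact hx
  · rw [E.shape _ _ (fun h' => h (add_right_cancel (b := 1) h'))]
    rfl

namespace hoPullback

variable {X Y Z : ZGChain G} {f : X ⟶ Z} {g : Y ⟶ Z}

lemma mk_mem_fixedSubmodule {H : Subgroup G} {n : ℤ} {x : X.X n} {y : Y.X n} {z : Z.X (n + 1)}
    (hx : x ∈ fixedSubmodule H (X.X n)) (hy : y ∈ fixedSubmodule H (Y.X n))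
    (hz : z ∈ fixedSubmodule H (Z.X (n + 1))) :
    (show (hoPullback f g).X n from (x, y, z)) ∈ fixedSubmodule H ((hoPullback f g).X n) :=
  fun h hh => Prod.ext (hx h hh) (Prod.ext (hy h hh) (hz h hh))

lemma components_mem_fixedSubmodule {H : Subgroup G} {n : ℤ}
    {t : X.X n × Y.X n × Z.X (n + 1)}
    (ht : (show (hoPullback f g).X n from t) ∈ fixedSubmodule H ((hoPullback f g).X n)) :
    t.1 ∈ fixedSubmodule H (X.X n) ∧ t.2.1 ∈ fixedSubmodule H (Y.X n) ∧
      t.2.2 ∈ fixedSubmodule H (Z.X (n + 1)) :=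
  ⟨fun h hh => congr_arg Prod.fst (ht h hh), fun h hh => congr_arg (fun t => t.2.1) (ht h hh),
    fun h hh => congr_arg (fun t => t.2.2) (ht h hh)⟩

lemma cycle_iff {n : ℤ} (t : X.X n × Y.X n × Z.X (n + 1)) :
    (∀ k, (hoPullback f g).d n k (show (hoPullback f g).X n from t) = 0) ↔
      (∀ k, X.d n k t.1 = 0) ∧ (∀ k, Y.d n k t.2.1 = 0) ∧
        Z.d (n + 1) n t.2.2 = f.f n t.1 - g.f n t.2.1 := by
  obtain ⟨n, rfl⟩ : ∃ k, k + 1 = n := ⟨n - 1, by simp⟩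
  constructor
  · intro h
    have h' := (hoPullback_d f g n t).symm.trans (h n)
    refine ⟨d_apply_eq_zero_of_succ (congr_arg Prod.fst h'),
      d_apply_eq_zero_of_succ (congr_arg (fun t => t.2.1) h'), ?_⟩
    exact (sub_eq_zero.1 (congr_arg (fun t => t.2.2) h')).symm
  · rintro ⟨h₁, h₂, h₃⟩
    refine d_apply_eq_zero_of_succ ((hoPullback_d f g n t).trans ?_)
    exact Prod.ext (h₁ n) (Prod.ext (h₂ n) (sub_eq_zero.2 h₃.symm))

end hoPullback

/-! ### Colocality of cell complexes. -/

section Colocal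

variable {X Y : ZGChain G} {f : X ⟶ Y}

/-- The usual replacement of `f` by a fibration: here the two homological conditions on `f` yield
strict lifts. -/
lemma fpLift_snd (hf : fpEquivalences G f) : FPLift (hoPullback.snd f (𝟙 Y)) := by
  intro H n e he b hb hd hdb
  obtain ⟨x, y, y'⟩ := e
  obtain ⟨hx, hy, hy'⟩ := hoPullback.components_mem_fixedSubmodule he
  obtain ⟨hdx, hdy, hxy⟩ := (hoPullback.cycle_iff (f := f) (g := 𝟙 Y) (x, y, y')).1 hd
  dsimp only at hx hy hy' hdx hdy hxy
  replace hdb : Y.d (n + 1) n b = y := hdb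
  replace hxy : Y.d (n + 1) n y' = f.f n x - y := hxy
  rw [fpEquivalences_iff] at hf
  -- Since `d b = y` and `d y' = f x - y`, the element `b + y'` bounds `f x`, so `x` is itself a
  -- boundary.
  obtain ⟨x₀, hx₀, hdx₀⟩ := (hf H n).1 x hx (b + y') (add_mem hb hy') hdx
    (by rw [map_add, hdb, hxy, add_sub_cancel])
  -- The error `f x₀ - b - y'` is a cycle, hence `f x₁ + d w` with `x₁` a cycle; subtracting `x₁`
  -- from `x₀` corrects the third component and leaves `d x₀` unchanged.
  obtain ⟨x₁, hx₁, w, hw, hdx₁, hdw⟩ := (hf H (n + 1)).2 (f.f _ x₀ - b - y')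
    (sub_mem (sub_mem (map_mem_fixedSubmodule _ hx₀) hb) hy')
    (d_apply_eq_zero_of_succ (by
      rw [map_sub, map_sub, ← f_d_apply, hdx₀, hdb, hxy, sub_self]))
  refine ⟨(x₀ - x₁, b, w), hoPullback.mk_mem_fixedSubmodule (sub_mem hx₀ hx₁) hb hw, ?_, rfl⟩
  refine (hoPullback_d f (𝟙 Y) n _).trans (Prod.ext ?_ (Prod.ext hdb ?_))
  · change X.d _ _ (x₀ - x₁) = x
    rw [map_sub, hdx₀, hdx₁, sub_zero]
  · change f.f _ (x₀ - x₁) - b - Y.d _ _ w = y'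
    rw [hdw, map_sub]
    abel

/-- The diagonal map from `X` to the homotopy pullback of `f` with itself. -/
def hoDiagonal (f : X ⟶ Y) : X ⟶ hoPullback f f :=
  hoPullback.lift f f (𝟙 X) (𝟙 X) (Homotopy.refl _)

/-- Injectivity on homology holds because the first projection is a retraction of the diagonal.
Surjectivity uses both conditions on `f`. -/
lemma fpEquivalences_hoDiagonal (hf : fpEquivalences G f) :
    fpEquivalences G (hoDiagonal f) := by
  rw [fpEquivalences_iff] at hf ⊢
  refine fun H n => ⟨fun x hx y hy hdx hdy => ?_, fun t ht hdt => ?_⟩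
  · refine ⟨_, (hoPullback.components_mem_fixedSubmodule hy).1, ?_⟩
    exact (congr_arg Prod.fst (hoPullback_d f f n y)).symm.trans (congr_arg Prod.fst hdy)
  · obtain ⟨x, x', z⟩ := t
    obtain ⟨hx, hx', hz⟩ := hoPullback.components_mem_fixedSubmodule ht
    obtain ⟨hdx, hdx', hdz⟩ := (hoPullback.cycle_iff (f := f) (g := f) (x, x', z)).1 hdt
    dsimp only at hx hx' hz hdx hdx' hdz
    -- The cycle `(x, x', z)` must differ from the diagonal `(x, x, 0)` by a boundary. As `-z`
    -- bounds `f (x' - x)`, there is `w₀` bounding `x' - x`; then `f w₀ + z` is a cycle, and writing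
    -- it as `f u + d v` gives the corrections to `w₀` and the last component.
    obtain ⟨w₀, hw₀, hdw₀⟩ := (hf H n).1 (x' - x) (sub_mem hx' hx) (-z) (neg_mem hz)
      (fun k => by rw [map_sub, hdx, hdx', sub_zero])
      (by rw [map_neg, hdz, map_sub, neg_sub])
    obtain ⟨u, hu, v, hv, hdu, hdv⟩ := (hf H (n + 1)).2 (f.f _ w₀ + z)
      (add_mem (map_mem_fixedSubmodule _ hw₀) hz)
      (d_apply_eq_zero_of_succ (by
        rw [map_add, ← f_d_apply, hdw₀, hdz, map_sub]
        abel))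
    refine ⟨x, hx, (0, w₀ - u, -v), hoPullback.mk_mem_fixedSubmodule (zero_mem _)
      (sub_mem hw₀ hu) (neg_mem hv), hdx, ?_⟩
    refine (hoPullback_d f f n _).trans (Prod.ext ?_ (Prod.ext ?_ ?_))
    · change X.d _ _ 0 = x - x
      rw [map_zero, sub_self]
    · change X.d _ _ (w₀ - u) = x' - x
      rw [map_sub, hdw₀, hdu, sub_zero]
    · change f.f _ 0 - f.f _ (w₀ - u) - Y.d _ _ (-v) = z - 0
      rw [map_neg, hdv, map_zero, map_sub]
      abel

lemma IsCellComplex.exists_homotopy_lift {C : ZGChain G} (hC : IsCellComplex C)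
    (hf : fpEquivalences G f) (g : C ⟶ Y) : ∃ h : C ⟶ X, Nonempty (Homotopy (h ≫ f) g) := by
  obtain ⟨q, hq⟩ := hC.exists_lift (fpLift_snd hf) g
  refine ⟨q ≫ hoPullback.fst f (𝟙 Y), ⟨?_⟩⟩
  refine (Homotopy.ofEq (Category.assoc _ _ _)).trans
    (((hoPullback.homotopy f (𝟙 Y)).compLeft q).trans (Homotopy.ofEq ?_))
  rw [Category.comp_id, hq]

/-- The homotopy `h` is a map from `C` to the homotopy pullback of `f` with itself. Up to homotopy
it factors through the diagonal as some `q : C ⟶ X`, and the two projections give `q ≃ a` and `q ≃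
b`. -/
lemma IsCellComplex.homotopic_of_comp {C : ZGChain G} (hC : IsCellComplex C)
    (hf : fpEquivalences G f) (a b : C ⟶ X) (h : Homotopy (a ≫ f) (b ≫ f)) :
    Nonempty (Homotopy a b) := by
  obtain ⟨q, ⟨hq⟩⟩ := hC.exists_homotopy_lift (fpEquivalences_hoDiagonal hf)
    (hoPullback.lift f f a b h)
  have h₁ : Homotopy q a := (Homotopy.ofEq (by
    rw [Category.assoc, hoDiagonal, hoPullback.lift_fst, Category.comp_id])).trans
      ((hq.compRight (hoPullback.fst f f)).trans (Homotopy.ofEq (hoPullback.lift_fst f f a b h)))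
  have h₂ : Homotopy q b := (Homotopy.ofEq (by
    rw [Category.assoc, hoDiagonal, hoPullback.lift_snd, Category.comp_id])).trans
      ((hq.compRight (hoPullback.snd f f)).trans (Homotopy.ofEq (hoPullback.lift_snd f f a b h)))
  exact ⟨h₁.symm.trans h₂⟩

end Colocal

/-- Cell complexes are colocal with respect to fp-equivalences. -/
lemma cellObjects_le_isColocal : cellObjects G ≤ (fpEquivalencesHo G).isColocal := by
  rintro _ ⟨C, hC, rfl⟩ X Y f hf
  obtain ⟨X, rfl⟩ := HomotopyCategory.quotient_obj_surjective X
  obtain ⟨Y, rfl⟩ := HomotopyCategory.quotient_obj_surjective Y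
  obtain ⟨f, rfl⟩ := (toHo G).map_surjective f
  rw [fpEquivalencesHo_map_iff] at hf
  constructor
  · intro a b hab
    obtain ⟨a, rfl⟩ := (toHo G).map_surjective a
    obtain ⟨b, rfl⟩ := (toHo G).map_surjective b
    dsimp only at hab
    rw [← Functor.map_comp, ← Functor.map_comp] at hab
    obtain ⟨h⟩ := hC.homotopic_of_comp hf a b (HomotopyCategory.homotopyOfEq _ _ hab)
    exact HomotopyCategory.eq_of_homotopy _ _ h
  · intro g
    obtain ⟨g, rfl⟩ := (toHo G).map_surjective g
    obtain ⟨h, ⟨H⟩⟩ := hC.exists_homotopy_lift hf g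
    refine ⟨(toHo G).map h, ?_⟩
    dsimp only
    rw [← Functor.map_comp]
    exact HomotopyCategory.eq_of_homotopy _ _ H

/-! ### Maps out of `ℤ[G/H][n]` and attachment of cells. -/

/-- The element of `ℤ[G/H][n]` which corresponds to the trivial coset. -/
def permComplexGen (H : Subgroup G) (n : ℤ) : (permComplex H n).X n :=
  (HomologicalComplex.singleObjXSelf (ComplexShape.down ℤ) n (permModule H)).inv (permGen H)

lemma permComplexGen_mem_fixedSubmodule (H : Subgroup G) (n : ℤ) :
    permComplexGen H n ∈ fixedSubmodule H ((permComplex H n).X n) :=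
  map_mem_fixedSubmodule _ (permGen_mem_fixedSubmodule H)

/-- The chain map from `ℤ[G/H][n]` given by an `H`-fixed cycle of degree `n`. -/
def permComplexDesc {E : ZGChain G} {H : Subgroup G} {n : ℤ} (e : E.X n)
    (he : e ∈ fixedSubmodule H (E.X n)) (hd : ∀ k, E.d n k e = 0) : permComplex H n ⟶ E :=
  HomologicalComplex.mkHomFromSingle (permDesc e he) (fun k _ => permModule_hom_ext (by
    rw [ConcreteCategory.comp_apply, permDesc_permGen, hd]
    rfl))

lemma permComplexDesc_gen {E : ZGChain G} {H : Subgroup G} {n : ℤ} (e : E.X n)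
    (he : e ∈ fixedSubmodule H (E.X n)) (hd : ∀ k, E.d n k e = 0) :
    (permComplexDesc e he hd).f n (permComplexGen H n) = e := by
  rw [permComplexDesc, HomologicalComplex.mkHomFromSingle_f]
  exact (ConcreteCategory.congr_hom (Iso.inv_hom_id_assoc (HomologicalComplex.singleObjXSelf
    (ComplexShape.down ℤ) n (permModule H)) (permDesc e he)) (permGen H)).trans
    (permDesc_permGen e he)

section Attach

variable {A X : ZGChain G} (γ : A ⟶ X)

/-- The cells to be attached to `A`: the fixed cycles of the homotopy fibre of `γ`. -/
def AttachingCells : Type u :=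
  Σ (H : Subgroup G) (n : ℤ), {t : (hoPullback γ (0 : A ⟶ X)).X n //
    t ∈ fixedSubmodule H ((hoPullback γ (0 : A ⟶ X)).X n) ∧
      ∀ k, (hoPullback γ (0 : A ⟶ X)).d n k t = 0}

/-- The source of the attaching map. -/
def attachSource : ZGChain G := ∐ fun i : AttachingCells γ => permComplex i.1 i.2.1

lemma isPermSum_attachSource : IsPermSum (attachSource γ) :=
  ⟨AttachingCells γ, fun i => i.1, fun i => i.2.1, ⟨Iso.refl _⟩⟩

/-- The map to the homotopy fibre which induces the attaching map. -/
def attachToHoPullback : attachSource γ ⟶ hoPullback γ (0 : A ⟶ X) :=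
  Sigma.desc fun i : AttachingCells γ => permComplexDesc i.2.2.1 i.2.2.2.1 i.2.2.2.2

/-- The attaching map. -/
def attachMap : attachSource γ ⟶ A := attachToHoPullback γ ≫ hoPullback.fst γ 0

/-- The null-homotopy of the composition of the attaching map with `γ`. -/
def attachHomotopy : Homotopy (attachMap γ ≫ γ) 0 :=
  (Homotopy.ofEq (Category.assoc _ _ _)).trans
    (((hoPullback.homotopy γ (0 : A ⟶ X)).compLeft (attachToHoPullback γ)).trans
      (Homotopy.ofEq (by rw [comp_zero, comp_zero])))

/-- The result of attaching cells to `A`. -/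
abbrev attach : ZGChain G := HomologicalComplex.homotopyCofiber (attachMap γ)

/-- The inclusion of `A`. -/
abbrev attachInr : A ⟶ attach γ := HomologicalComplex.homotopyCofiber.inr (attachMap γ)

/-- The extension of `γ`. -/
def attachDesc : attach γ ⟶ X :=
  HomologicalComplex.homotopyCofiber.desc (attachMap γ) γ (attachHomotopy γ)

lemma attachInr_attachDesc : attachInr γ ≫ attachDesc γ = γ :=
  HomologicalComplex.homotopyCofiber.inr_desc _ _ _

lemma mono_attachInr_f (n : ℤ) : Mono ((attachInr γ).f n) := by
  have h : (attachInr γ).f n ≫ HomologicalComplex.homotopyCofiber.sndX (attachMap γ) n =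
      𝟙 (A.X n) := HomologicalComplex.homotopyCofiber.inrX_sndX (attachMap γ) n
  exact mono_of_mono_fac h

/-- One attachment solves every lifting problem posed by `γ`: each pair `(e, b)` indexes a cell
whose cone generator has boundary `e` and image `b`. -/
lemma attach_solves (H : Subgroup G) (n : ℤ) (e : A.X n) (he : e ∈ fixedSubmodule H (A.X n))
    (b : X.X (n + 1)) (hb : b ∈ fixedSubmodule H (X.X (n + 1))) (hd : ∀ k, A.d n k e = 0)
    (hdb : X.d (n + 1) n b = γ.f n e) :
    ∃ z ∈ fixedSubmodule H ((attach γ).X (n + 1)),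
      (attach γ).d (n + 1) n z = (attachInr γ).f n e ∧ (attachDesc γ).f (n + 1) z = b := by
  -- The homotopy pullback of `γ` with `0 : A ⟶ X` is the homotopy fibre plus a spare copy of `A`;
  -- the spare component is set to `0`.
  let t : (hoPullback γ (0 : A ⟶ X)).X n := (e, (0 : A.X n), b)
  have ht : t ∈ fixedSubmodule H ((hoPullback γ (0 : A ⟶ X)).X n) :=
    hoPullback.mk_mem_fixedSubmodule he (zero_mem _) hb
  have htd : ∀ k, (hoPullback γ (0 : A ⟶ X)).d n k t = 0 :=
    (hoPullback.cycle_iff (f := γ) (g := (0 : A ⟶ X)) _).2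
      ⟨hd, fun k => map_zero _, hdb.trans (sub_zero _).symm⟩
  let i : AttachingCells γ := ⟨H, n, t, ht, htd⟩
  let ιi : permComplex H n ⟶ attachSource γ :=
    Sigma.ι (fun i : AttachingCells γ => permComplex i.1 i.2.1) i
  have hι : ιi ≫ attachToHoPullback γ = permComplexDesc t ht htd :=
    Sigma.ι_desc (fun i : AttachingCells γ => permComplexDesc i.2.2.1 i.2.2.2.1 i.2.2.2.2) i
  let x : (attachSource γ).X n := ιi.f n (permComplexGen H n)
  have hx : (attachToHoPullback γ).f n x = t := by
    rw [← permComplexDesc_gen t ht htd, ← hι]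
    rfl
  have hrel : (ComplexShape.down ℤ).Rel (n + 1) n := rfl
  refine ⟨HomologicalComplex.homotopyCofiber.inlX (attachMap γ) n (n + 1) hrel x,
    map_mem_fixedSubmodule _ (map_mem_fixedSubmodule _ (permComplexGen_mem_fixedSubmodule H n)),
    ?_, ?_⟩
  · have h := HomologicalComplex.homotopyCofiber.inlX_d (attachMap γ) (n + 1) n (n - 1) hrel
      (by simp)
    -- The differential of the cone on the shifted source is minus that of the source, which
    -- vanishes, plus the attaching map.
    rw [(isPermSum_attachSource γ).d_eq_zero, zero_comp, neg_zero, zero_add] at h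
    refine (ConcreteCategory.congr_hom h x).trans ?_
    change (attachInr γ).f n ((hoPullback.fst γ 0).f n ((attachToHoPullback γ).f n x)) = _
    rw [hx]
    rfl
  · refine (ConcreteCategory.congr_hom (HomologicalComplex.homotopyCofiber.inlX_desc_f
      (attachMap γ) γ (attachHomotopy γ) n (n + 1) hrel) x).trans ?_
    have h : (attachHomotopy γ).hom n (n + 1) =
        (attachToHoPullback γ).f n ≫ hoPullback.thd γ 0 n (n + 1) rfl := by
      simp [attachHomotopy, hoPullback.homotopy]
    rw [h, ConcreteCategory.comp_apply, hx]
    rfl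

end Attach

/-! ### Cellular approximation by a small object argument. -/

section Approximation

open scoped ZeroObject

variable (X : ZGChain G)

/-- The stages of the cellular approximation of `X`. -/
def cellStage : ℕ → Over X
  -- Each stage carries its map to `X`, since the next cells depend on that map.
  | 0 => Over.mk (0 : (0 : ZGChain G) ⟶ X)
  | k + 1 => Over.mk (attachDesc (cellStage k).hom)

/-- The sequence of stages of the cellular approximation of `X`. -/
def cellSequence : ℕ ⥤ ZGChain G :=
  Functor.ofSequence (X := fun k => (cellStage X k).left) (fun k => attachInr (cellStage X k).hom)

lemma cellSequence_map_succ (k : ℕ) :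
    (cellSequence X).map (homOfLE (Nat.le_add_right k 1)) = attachInr (cellStage X k).hom :=
  Functor.ofSequence_map_homOfLE_succ _ k

/-- The cocone formed by the maps from the stages to `X`. -/
def cellCocone : Cocone (cellSequence X) where
  pt := X
  ι := NatTrans.ofSequence (fun k => (cellStage X k).hom) (fun k => by
    rw [cellSequence_map_succ]
    exact (attachInr_attachDesc _).trans (Category.comp_id _).symm)

/-- The cellular approximation of `X`. -/
def cellApprox : ZGChain G := colimit (cellSequence X)

/-- The map from the cellular approximation to `X`. -/
def cellApproxMap : cellApprox X ⟶ X := colimit.desc _ (cellCocone X)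

lemma isCellComplex_cellApprox : IsCellComplex (cellApprox X) := by
  refine ⟨cellSequence X, colimit.cocone _, isZero_zero _, fun k => ?_, ⟨colimit.isColimit _⟩,
    ⟨Iso.refl _⟩⟩
  refine ⟨_, attachMap (cellStage X k).hom, Iso.refl _, isPermSum_attachSource _, ?_⟩
  exact (Category.comp_id _).trans (cellSequence_map_succ X k)

lemma mono_cellSequence_map_f {k l : ℕ} (h : k ≤ l) (n : ℤ) :
    Mono (((cellSequence X).map (homOfLE h)).f n) := by
  induction l, h using Nat.le_induction with
  | base =>
    have : (cellSequence X).map (homOfLE (le_refl k)) = 𝟙 _ := (cellSequence X).map_id k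
    rw [this, HomologicalComplex.id_f]
    infer_instance
  | succ l h ih =>
    have h' : Mono (((cellSequence X).map (homOfLE (Nat.le_add_right l 1))).f n) := by
      rw [cellSequence_map_succ]
      exact mono_attachInr_f (cellStage X l).hom n
    have : (cellSequence X).map (homOfLE (h.trans (Nat.le_add_right l 1))) =
        (cellSequence X).map (homOfLE h) ≫ (cellSequence X).map (homOfLE (Nat.le_add_right l 1)) :=
      (cellSequence X).map_comp _ _
    rw [this, HomologicalComplex.comp_f]
    exact mono_comp _ _

instance : PreservesFilteredColimitsOfSize.{0, 0} (forget (ZGMod G)) :=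
  preservesSmallestFilteredColimits_of_preservesFilteredColimits _

/-- The colimit cocone of `cellSequence X` in degree `n`. -/
def cellApproxIsColimit (n : ℤ) :
    IsColimit ((HomologicalComplex.eval _ _ n).mapCocone (colimit.cocone (cellSequence X))) :=
  isColimitOfPreserves _ (colimit.isColimit _)

lemma colimit_ι_cellSequence_injective (k : ℕ) (n : ℤ) :
    Function.Injective ((colimit.ι (cellSequence X) k).f n) := by
  intro x y hxy
  obtain ⟨l, f, g, h⟩ := Concrete.isColimit_exists_of_rep_eq _ (cellApproxIsColimit X n) x y hxy
  obtain rfl := Subsingleton.elim f g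
  exact (ModuleCat.mono_iff_injective _).1 (mono_cellSequence_map_f X (leOfHom f) n) h

lemma exists_colimit_ι_cellSequence_eq (n : ℤ) (e : (cellApprox X).X n) :
    ∃ (k : ℕ) (x : ((cellSequence X).obj k).X n), (colimit.ι (cellSequence X) k).f n x = e :=
  Concrete.isColimit_exists_rep _ (cellApproxIsColimit X n) e

/-- A lifting problem involves a single element `e`, which comes from a finite stage `k`. The stages
embed in the colimit, so the preimage of `e` is already fixed and a cycle there, and stage `k + 1`
solves the problem. -/
lemma fpLift_cellApproxMap : FPLift (cellApproxMap X) := by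
  intro H n e he b hb hd hdb
  obtain ⟨k, x, rfl⟩ := exists_colimit_ι_cellSequence_eq X n e
  have hι : ∀ k, colimit.ι (cellSequence X) k ≫ cellApproxMap X = (cellStage X k).hom :=
    fun k => colimit.ι_desc _ _
  have hx : x ∈ fixedSubmodule H (((cellSequence X).obj k).X n) := fun h hh => by
    apply colimit_ι_cellSequence_injective X k n
    rw [map_smul]
    exact he h hh
  have hdx : ∀ j, ((cellSequence X).obj k).d n j x = 0 := fun j => by
    apply colimit_ι_cellSequence_injective X k j
    rw [f_d_apply, map_zero]
    exact hd j
  have hbx : X.d (n + 1) n b = (cellStage X k).hom.f n x := by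
    rw [hdb, ← hι k]
    rfl
  obtain ⟨z, hz, hdz, hzb⟩ := attach_solves (cellStage X k).hom H n x hx b hb hdx hbx
  refine ⟨(colimit.ι (cellSequence X) (k + 1)).f (n + 1) z, map_mem_fixedSubmodule _ hz, ?_, ?_⟩
  · refine (f_d_apply (colimit.ι (cellSequence X) (k + 1)) (n + 1) n z).symm.trans ?_
    refine (congr_arg _ hdz).trans ?_
    have h := colimit.w (cellSequence X) (homOfLE (Nat.le_add_right k 1))
    rw [cellSequence_map_succ] at h
    exact congr($(h).f n x)
  · rw [← hzb]
    exact congr($(hι (k + 1)).f (n + 1) z)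

end Approximation

lemma FPLift.fpEquivalences {E B : ZGChain G} {p : E ⟶ B} (hp : FPLift p) :
    fpEquivalences G p := by
  rw [fpEquivalences_iff]
  refine fun H n => ⟨fun x hx y hy hd hdy => ?_, fun y hy hd => ?_⟩
  · obtain ⟨z, hz, hdz, -⟩ := hp H n x hx y hy hd hdy
    exact ⟨z, hz, hdz⟩
  · obtain ⟨n, rfl⟩ : ∃ k, k + 1 = n := ⟨n - 1, by simp⟩
    -- Lifting against `e = 0` lifts the cycle `y` to a cycle strictly, so no bounding element is
    -- needed.
    obtain ⟨z, hz, hdz, hzy⟩ := hp H n 0 (zero_mem _) y hy (fun _ => map_zero _)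
      ((hd n).trans (map_zero _).symm)
    exact ⟨z, hz, 0, zero_mem _, d_apply_eq_zero_of_succ hdz, by rw [hzy, sub_self, map_zero]⟩

/-- Every complex receives an fp-equivalence from a cell complex. -/
lemma exists_cell_approximation (X : ZGChain G) :
    ∃ (C : ZGChain G) (γ : C ⟶ X), IsCellComplex C ∧ fpEquivalences G γ :=
  ⟨cellApprox X, cellApproxMap X, isCellComplex_cellApprox X,
    (fpLift_cellApproxMap X).fpEquivalences⟩

/-! ### Coreflection onto colocal objects as a localization. -/

section Coreflection

variable {C : Type*} [Category* C] (P : ObjectProperty C) (W : MorphismProperty C)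

/-- If colocal objects provide enough approximations, the inclusion of the full subcategory they
form has a right adjoint, with counit the approximations. -/
lemma exists_rightAdjoint_of_isColocal (hP : P ≤ W.isColocal)
    (h : ∀ X : C, ∃ (Y : C) (γ : Y ⟶ X), P Y ∧ W γ) :
    ∃ (Γ : C ⥤ P.FullSubcategory) (adj : P.ι ⊣ Γ), ∀ X, W (adj.counit.app X) := by
  choose Y γ hY hγ using h
  let e (A : P.FullSubcategory) (X : C) : (P.ι.obj A ⟶ X) ≃ (A ⟶ ⟨Y X, hY X⟩) :=
    ((P.fullyFaithfulι.homEquiv (X := A) (Y := ⟨Y X, hY X⟩)).trans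
      (Equiv.ofBijective _ (hP _ A.property (γ X) (hγ X)))).symm
  have he (A' A : P.FullSubcategory) (X : C) (f : A' ⟶ A) (g : P.ι.obj A ⟶ X) :
      e A' X (P.ι.map f ≫ g) = f ≫ e A X g := by
    obtain ⟨g, rfl⟩ := (e A X).symm.surjective g
    rw [Equiv.apply_symm_apply, ← Equiv.eq_symm_apply]
    exact (Category.assoc _ _ _).symm
  refine ⟨_, Adjunction.adjunctionOfEquivRight e he, fun X => ?_⟩
  have h : (Adjunction.adjunctionOfEquivRight e he).counit.app X = γ X :=
    (Adjunction.adjunctionOfEquivRight_counit_app e he X).trans (Category.id_comp _)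
  rw [h]
  exact hγ X

/-- A right adjoint of the inclusion of colocal objects whose counit belongs to `W` is a
localization with respect to `W`. -/
lemma isLocalization_of_isColocal [W.HasTwoOutOfThreeProperty]
    (hW : MorphismProperty.isomorphisms C ≤ W) (hP : P ≤ W.isColocal) {Γ : C ⥤ P.FullSubcategory} (adj : P.ι ⊣ Γ)
    (hadj : ∀ X, W (adj.counit.app X)) : Γ.IsLocalization W := by
  -- `W` is exactly the class of maps that the objects of `P` see as isomorphisms. If `Γ f` is
  -- invertible, naturality of the counit and two-out-of-three put `f` in `W`.
  have hW' : W = ObjectProperty.isColocal (· ∈ Set.range P.ι.obj) := by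
    ext X Y f
    constructor
    · rintro hf _ ⟨A, rfl⟩
      exact hP _ A.property f hf
    · intro hf
      rw [ObjectProperty.isColocal_iff_isIso_map adj] at hf
      have h : P.ι.map (Γ.map f) ≫ adj.counit.app Y = adj.counit.app X ≫ f :=
        adj.counit.naturality f
      refine W.of_precomp (adj.counit.app X) f (hadj X) ?_
      rw [← h]
      have : IsIso (P.ι.map (Γ.map f)) := inferInstance
      exact W.comp_mem _ _ (hW _ this) (hadj Y)
  rw [hW']
  exact ObjectProperty.isLocalization_isColocal adj

end Coreflection

/-! ### From the homotopy category back to chain complexes. -/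

variable (G)

instance : (fpEquivalencesHo G).HasTwoOutOfThreeProperty where
  comp_mem f g hf hg H n := by
    have := hf H n
    have := hg H n
    rw [Functor.map_comp, Functor.map_comp]
    infer_instance
  of_postcomp f g hg hfg H n := by
    have := hg H n
    have := hfg H n
    rw [Functor.map_comp, Functor.map_comp] at this
    exact IsIso.of_isIso_comp_right _ (((HomotopyCategory.homologyFunctor (ModuleCat.{u} ℤ)
      (ComplexShape.down ℤ) n).map (((fixedPoints H).mapHomotopyCategory _).map g)))
  of_precomp f g hf hfg H n := by
    have := hf H n
    have := hfg H n
    rw [Functor.map_comp, Functor.map_comp] at this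
    exact IsIso.of_isIso_comp_left ((HomotopyCategory.homologyFunctor (ModuleCat.{u} ℤ)
      (ComplexShape.down ℤ) n).map (((fixedPoints H).mapHomotopyCategory _).map f)) _

lemma isomorphisms_le_fpEquivalencesHo :
    MorphismProperty.isomorphisms (ZGHo G) ≤ fpEquivalencesHo G := by
  intro X Y f (hf : IsIso f) H n
  infer_instance

/-- The fp-equivalences of chain complexes are localized by localizing the homotopy category. -/
lemma isLocalization_toHo_comp {D : Type*} [Category* D] (L : ZGHo G ⥤ D)
    [L.IsLocalization (fpEquivalencesHo G)] :
    (toHo G ⋙ L).IsLocalization (fpEquivalences G) := by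
  -- The quotient functor is itself the localization at homotopy equivalences. These are
  -- fp-equivalences, and every fp-equivalence in the homotopy category has a representative that is
  -- one.
  refine Functor.IsLocalization.comp (toHo G) L
    (HomologicalComplex.homotopyEquivalences (ZGMod G) (ComplexShape.down ℤ))
    (fpEquivalencesHo G) (fpEquivalences G) ?_ ?_ ?_
  · intro X Y f hf
    exact Localization.inverts L (fpEquivalencesHo G) _ ((fpEquivalencesHo_map_iff f).2 hf)
  · intro X Y f hf
    have : IsIso ((toHo G).map f) := HomotopyCategory.quotient_inverts_homotopyEquivalences _ _ f hf
    exact (fpEquivalencesHo_map_iff f).1 (isomorphisms_le_fpEquivalencesHo G _ this)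
  · intro X Y f hf
    obtain ⟨X, rfl⟩ := HomotopyCategory.quotient_obj_surjective X
    obtain ⟨Y, rfl⟩ := HomotopyCategory.quotient_obj_surjective Y
    obtain ⟨f, rfl⟩ := (toHo G).map_surjective f
    exact MorphismProperty.map_mem_map _ _ _ ((fpEquivalencesHo_map_iff f).1 hf)

end FPDerived

end

theorem mainTheorem12 (G : Type u) [Group G] :
    -- the localization at the fp-equivalences exists, with hom-sets in the same universe
    (∃ (D : Type (u + 1)) (_ : Category.{u} D) (L : FPDerived.ZGChain G ⥤ D),
      L.IsLocalization (FPDerived.fpEquivalences G)) ∧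
    -- cell complexes are colocal for the fp-equivalences in the homotopy category
    FPDerived.cellObjects G ≤ (FPDerived.fpEquivalencesHo G).isColocal ∧
    -- every chain complex receives an fp-equivalence from a cell complex
    (∀ X : FPDerived.ZGChain G, ∃ (C : FPDerived.ZGChain G) (γ : C ⟶ X),
      FPDerived.IsCellComplex C ∧ FPDerived.fpEquivalences G γ) ∧
    -- the resulting colocalization functor, right adjoint to the inclusion of cell complexes,
    -- is the localization
    (∃ (Γ : FPDerived.ZGHo G ⥤ FPDerived.CellHo G) (adj : (FPDerived.cellObjects G).ι ⊣ Γ),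
      (∀ X : FPDerived.ZGHo G, FPDerived.fpEquivalencesHo G (adj.counit.app X)) ∧
      Γ.IsLocalization (FPDerived.fpEquivalencesHo G) ∧
      (FPDerived.toHo G ⋙ Γ).IsLocalization (FPDerived.fpEquivalences G)) := by
  obtain ⟨Γ, adj, hadj⟩ := FPDerived.exists_rightAdjoint_of_isColocal (FPDerived.cellObjects G)
    (FPDerived.fpEquivalencesHo G) FPDerived.cellObjects_le_isColocal (fun X => by
      obtain ⟨X, rfl⟩ := HomotopyCategory.quotient_obj_surjective X
      obtain ⟨C, γ, hC, hγ⟩ := FPDerived.exists_cell_approximation X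
      exact ⟨_, (FPDerived.toHo G).map γ, ⟨C, hC, rfl⟩, (FPDerived.fpEquivalencesHo_map_iff γ).2 hγ⟩)
  have hΓ : Γ.IsLocalization (FPDerived.fpEquivalencesHo G) :=
    FPDerived.isLocalization_of_isColocal _ _
      (FPDerived.isomorphisms_le_fpEquivalencesHo G) FPDerived.cellObjects_le_isColocal adj hadj
  have hΓ' := FPDerived.isLocalization_toHo_comp G Γ
  exact ⟨⟨FPDerived.CellHo G, inferInstance, _, hΓ'⟩, FPDerived.cellObjects_le_isColocal,
    FPDerived.exists_cell_approximation, Γ, adj, hadj, hΓ, hΓ'⟩
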